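/- There are $n$ independent channels, each a two-state Markov chain (state $1$ good, state $0$ bad) with the same transition matrix $(p_{ij})_{i,j\in\{0,1\}}$, where $p_{ij}$ is the probability of a transition from $i$ to $j$. Put $\tau(x)=x\,p_{11}+(1-x)\,p_{01}$. The information state at time $t$ is a vector $\omega(t)\in[0,1]^n$, $\omega_i(t)$ being the conditional probability that channel $i$ is good. When channel $a$ is sensed at the information state $\omega$, it is found good with probability $\omega_a$ (reward $1$) and bad with probability $1-\omega_a$ (reward $0$); the next information state $\mathcal T(\omega,a\mid 1)$, respectively $\mathcal T(\omega,a\mid 0)$, has $a$-th coordinate $p_{11}$, respectively $p_{01}$, and $j$-th coordinate $\tau(\omega_j)$ for $j\ne a$. For a policy $\pi$ (in general history-dependent and randomized), an initial information state $\omega$, a horizon $T$ and $\beta\in[0,1]$ let $J^{\pi}_{T,\beta}(\omega)=E^\pi\big[\sum_{t=1}^T\beta^{t-1}R_t\mid\omega(1)=\omega\big]$, where $R_t$ is the reward at time $t$, and write $J^\pi_T=J^\pi_{T,1}$. Let $\pi^*$ be a myopic policy, i.e. a stationary policy that at each information state $\omega$ senses a channel $a$ with $\omega_a=\max_b\omega_b$,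 ties being broken in an arbitrary, possibly random, way as a function of $\omega$. Assume that $\pi^*$ is optimal for the finite-horizon problem: for all $T\ge1$, $\beta\in[0,1]$ and $\omega\in[0,1]^n$, $J^{\pi^*}_{T,\beta}(\omega)\ge J^{\pi}_{T,\beta}(\omega)$ for every deterministic Markov policy $\pi=(\pi_1,\dots,\pi_T)$, $\pi_t$ being a map from information states to channels. (i) If $|p_{11}-p_{00}|<1$, then $\pi^*$ is optimal, in the strong sense, for the infinite-horizon average-reward problem: for every $\omega\in[0,1]^n$ the limit $\lim_{T\to\infty}\frac1T J^{\pi^*}_T(\omega)$ exists, and $$\lim_{T\to\infty}\frac1T J^{\pi^*}_T(\omega)\ \ge\ \limsup_{T\to\infty}\frac1T J^{\pi}_T(\omega)$$ for every history-dependent randomized policy $\pi$. (ii) If $|p_{11}-p_{01}|<1$, then $\pi^*$ is optimal for the average-reward problem in the same strong sense, and moreover there are a constant $J$ and a bounded function $h$ on $[0,1]^n$ such that for all $\omega\in[0,1]^n$ $$J+h(\omega)=\max_{a=1,\dots,n}\big(\omega_a+\omega_a\,h(\mathcal T(\omega,a\mid1))+(1-\omega_a)\,h(\mathcal T(\omega,a\mid0))\big),$$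 the policy $\pi^*$ attains this maximum, and $\lim_{T\to\infty}\frac1T J^{\pi^*}_T(\omega)=J$ for all $\omega\in[0,1]^n$. -/

import Mathlib

namespace ChannelSensing

open Filter Topology

/-- Information state (belief vector): `ω i` is the conditional probability that channel `i` is in
the good state `1`. Only vectors with all entries in `[0,1]` are meaningful, see `IsBelief`. -/
abbrev Belief (n : ℕ) : Type := Fin n → ℝ

/-- `ω ∈ [0,1]ⁿ`. -/
def IsBelief {n : ℕ} (ω : Belief n) : Prop := ∀ i, ω i ∈ Set.Icc (0 : ℝ) 1

/-- A history, most recent step first: the channels sensed so far together with the outcomes of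
sensing (`true` is the good state `1`, `false` is the bad state `0`). -/
abbrev History (n : ℕ) : Type := List (Fin n × Bool)

/-- A (history-dependent, randomized) policy: given the initial belief vector and the history, a
probability distribution on the channels. -/
abbrev Policy (n : ℕ) : Type := Belief n → History n → stdSimplex ℝ (Fin n)

/-- One-step evolution of the belief of an unobserved channel, for the transition matrix `p` of a
channel (`p i j` is the probability of a transition from state `i` to state `j`). -/
def tau (p : Matrix (Fin 2) (Fin 2) ℝ) (x : ℝ) : ℝ := x * p 1 1 + (1 - x) * p 0 1

/-- The next belief vector when channel `a` is sensed at `ω` with outcome `o`. -/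
def next {n : ℕ} (p : Matrix (Fin 2) (Fin 2) ℝ) (ω : Belief n) (a : Fin n) (o : Bool) : Belief n :=
  fun j => if j = a then (if o then p 1 1 else p 0 1) else tau p (ω j)

/-- The belief vector after a history, started from `ω`. -/
def beliefAfter {n : ℕ} (p : Matrix (Fin 2) (Fin 2) ℝ) (ω : Belief n) : History n → Belief n
  | [] => ω
  | (a, o) :: h => next p (beliefAfter p ω h) a o

/-- Probability of the sensing outcome `o` on a channel that is good with probability `x`. -/
def outcomeProb (x : ℝ) (o : Bool) : ℝ := if o then x else 1 - x

/-- Probability of a history under the policy `π` and the initial belief vector `ω`. -/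
def historyProb {n : ℕ} (p : Matrix (Fin 2) (Fin 2) ℝ) (π : Policy n) (ω : Belief n) :
    History n → ℝ
  | [] => 1
  | (a, o) :: h =>
      historyProb p π ω h * (π ω h).1 a * outcomeProb (beliefAfter p ω h a) o

/-- Discounted total reward `∑ t, β ^ (t - 1) R_t` collected along a history; the reward of a step
is `1` if the sensed channel is good and `0` otherwise. -/
def totalReward {n : ℕ} (β : ℝ) : History n → ℝ
  | [] => 0
  | (_, o) :: h => totalReward β h + β ^ h.length * (if o then 1 else 0)

/-- Expected discounted reward over the horizon `T` under `π`, started from `ω`: the expectation of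
`totalReward` over the histories of length `T`. -/
noncomputable def expReward {n : ℕ} (p : Matrix (Fin 2) (Fin 2) ℝ) (π : Policy n) (β : ℝ) (T : ℕ)
    (ω : Belief n) : ℝ :=
  ∑ h : Fin T → Fin n × Bool, historyProb p π ω (List.ofFn h) * totalReward β (List.ofFn h)

/-- The deterministic Markov (separated) policy that senses channel `d t ω(t)` at time `t`; times
are counted from `0` here. -/
noncomputable def markovPolicy {n : ℕ} (p : Matrix (Fin 2) (Fin 2) ℝ)
    (d : ℕ → Belief n → Fin n) : Policy n :=
  fun ω h => ⟨Pi.single (d h.length (beliefAfter p ω h)) 1, single_mem_stdSimplex ℝ _⟩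

/-- The stationary (randomized) separated policy given by a decision rule. -/
def stationaryPolicy {n : ℕ} (p : Matrix (Fin 2) (Fin 2) ℝ)
    (μ : Belief n → stdSimplex ℝ (Fin n)) : Policy n :=
  fun ω h => μ (beliefAfter p ω h)

/-- A decision rule is myopic if it only selects channels of maximal belief (maximal expected
immediate reward); ties are broken in an arbitrary, possibly random, way. -/
def IsMyopic {n : ℕ} (μ : Belief n → stdSimplex ℝ (Fin n)) : Prop :=
  ∀ ω, IsBelief ω → ∀ a, 0 < (μ ω).1 a → ∀ b, ω b ≤ ω a

/-- `π` is optimal for the finite-horizon problem, for all horizons, discount factors `0 ≤ β ≤ 1`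
and initial beliefs: it attains the maximum over the deterministic Markov policies. -/
def OptimalFiniteHorizon {n : ℕ} (p : Matrix (Fin 2) (Fin 2) ℝ) (π : Policy n) : Prop :=
  ∀ T : ℕ, 1 ≤ T → ∀ β : ℝ, 0 ≤ β → β ≤ 1 → ∀ ω : Belief n, IsBelief ω →
    ∀ d : ℕ → Belief n → Fin n, expReward p (markovPolicy p d) β T ω ≤ expReward p π β T ω

/-- `π` is strongly optimal for the average-reward problem: for each initial belief vector its
average expected reward converges, and the limit is at least the limsup of the average expected
reward of every (history-dependent, randomized) policy. -/
def StronglyOptimalAverage {n : ℕ} (p : Matrix (Fin 2) (Fin 2) ℝ) (π : Policy n) : Prop :=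
  ∀ ω : Belief n, IsBelief ω → ∃ J : ℝ,
    Tendsto (fun T : ℕ => expReward p π 1 T ω / T) atTop (𝓝 J) ∧
    ∀ π' : Policy n, limsup (fun T : ℕ => expReward p π' 1 T ω / T) atTop ≤ J

/-- Expected immediate reward plus expected value of `f` at the next belief vector when channel `a`
is sensed at `ω`. -/
def actionValue {n : ℕ} (p : Matrix (Fin 2) (Fin 2) ℝ) (f : Belief n → ℝ) (ω : Belief n)
    (a : Fin n) : ℝ :=
  ω a + ω a * f (next p ω a true) + (1 - ω a) * f (next p ω a false)

/-- `(J, f, μ)` is a canonical triplet: `(J, f)` solves the average-reward optimality equation on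
`[0,1]ⁿ`, and the decision rule `μ` attains the maximum in it. -/
def IsCanonicalTriplet {n : ℕ} (p : Matrix (Fin 2) (Fin 2) ℝ) (J : ℝ) (f : Belief n → ℝ)
    (μ : Belief n → stdSimplex ℝ (Fin n)) : Prop :=
  ∀ ω : Belief n, IsBelief ω →
    IsGreatest (Set.range (actionValue p f ω)) (J + f ω) ∧
    J + f ω = ∑ a, (μ ω).1 a * actionValue p f ω a

end ChannelSensing

namespace ChannelSensing

open Filter Topology

variable {n : ℕ} {p : Matrix (Fin 2) (Fin 2) ℝ}

/-! Write `v T` for the value of the myopic rule over horizon `T`. By dynamic programming some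
deterministic Markov policy is optimal among all policies, so finite-horizon optimality makes `v T`
the optimal value (`optValue_eq_ruleValue`). The limsup comparison then holds horizon by horizon,
and it remains to prove that `v T ω / T` converges.

Let `δ = |p 1 1 - p 0 1|`, the factor by which `tau` scales differences of beliefs. If `δ < 1`, the
`v T` are Lipschitz in the `ℓ¹` distance with constant `1 / (1 - δ)` for every `T`, hence of
uniformly bounded oscillation. Cesàro averages of `v T - v T ω₀` have pointwise limits along an
ultrafilter, and these solve the optimality equation (`exists_canonicalTriplet`). Iterating that
equation gives `v T ω = T * J + O(1)`.

If `δ = 1`, the states are frozen or alternate, and the limit may depend on `ω`. Here `v T` is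
compared with a potential describing a clairvoyant who is rewarded whenever some channel is good. A
myopic choice can fall short of this reward only by sensing an uncertain channel, which is certain
ever after, so the total loss is at most the number of uncertain channels
(`ruleValue_mem_Icc_of_potential`). -/

/-! ### Invariance of `[0,1]ⁿ` and positivity. -/

/-- Both possible beliefs about a channel that has just been sensed are probabilities. -/
def IsTransition (p : Matrix (Fin 2) (Fin 2) ℝ) : Prop :=
  p 1 1 ∈ Set.Icc (0 : ℝ) 1 ∧ p 0 1 ∈ Set.Icc (0 : ℝ) 1

theorem isTransition_of_mem_rowStochastic (hp : p ∈ Matrix.rowStochastic ℝ (Fin 2)) :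
    IsTransition p := by
  rw [Matrix.mem_rowStochastic_iff_sum] at hp
  obtain ⟨h0, h1⟩ := hp
  have a := h1 0
  have b := h1 1
  rw [Fin.sum_univ_two] at a b
  exact ⟨⟨h0 1 1, by linarith [h0 1 0]⟩, ⟨h0 0 1, by linarith [h0 0 0]⟩⟩

theorem tau_mem_Icc (hp : IsTransition p) {x : ℝ} (hx : x ∈ Set.Icc (0 : ℝ) 1) :
    tau p x ∈ Set.Icc (0 : ℝ) 1 := by
  obtain ⟨⟨h1, h2⟩, h3, h4⟩ := hp
  obtain ⟨h5, h6⟩ := hx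
  unfold tau
  constructor
  · nlinarith
  · nlinarith

theorem isBelief_next (hp : IsTransition p) {ω : Belief n} (hω : IsBelief ω) (a : Fin n)
    (o : Bool) : IsBelief (next p ω a o) := by
  intro j
  unfold next
  split_ifs
  · exact hp.1
  · exact hp.2
  · exact tau_mem_Icc hp (hω j)

theorem isBelief_beliefAfter (hp : IsTransition p) {ω : Belief n} (hω : IsBelief ω)
    (h : History n) : IsBelief (beliefAfter p ω h) := by
  induction h with
  | nil => exact hω
  | cons x h ih => exact isBelief_next hp ih _ _

theorem historyProb_nonneg (hp : IsTransition p) (π : Policy n) {ω : Belief n}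
    (hω : IsBelief ω) (h : History n) : 0 ≤ historyProb p π ω h := by
  induction h with
  | nil => exact zero_le_one
  | cons x h ih =>
    obtain ⟨a, o⟩ := x
    refine mul_nonneg (mul_nonneg ih ((π ω h).2.1 a)) ?_
    have := isBelief_beliefAfter hp hω h a
    unfold outcomeProb
    split_ifs
    · exact this.1
    · linarith [this.2]

theorem totalReward_nonneg (h : History n) : 0 ≤ totalReward 1 h := by
  induction h with
  | nil => exact le_rfl
  | cons x h ih =>
    refine add_nonneg ih ?_
    split_ifs <;> simp

/-! ### Expectations over histories and backward induction. -/

/-- Expectation of a function of the history of length `t` under the policy `π`. -/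
noncomputable def expect (p : Matrix (Fin 2) (Fin 2) ℝ) (π : Policy n) (ω : Belief n) (t : ℕ)
    (F : History n → ℝ) : ℝ :=
  ∑ h : Fin t → Fin n × Bool, historyProb p π ω (List.ofFn h) * F (List.ofFn h)

theorem expect_zero (π : Policy n) (ω : Belief n) (F : History n → ℝ) :
    expect p π ω 0 F = F [] := by
  simp [expect, historyProb]

theorem expect_succ (π : Policy n) (ω : Belief n) (t : ℕ) (F : History n → ℝ) :
    expect p π ω (t + 1) F = expect p π ω t fun h => ∑ a, (π ω h).1 a *
      (beliefAfter p ω h a * F ((a, true) :: h) +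
        (1 - beliefAfter p ω h a) * F ((a, false) :: h)) := by
  unfold expect
  rw [← (Fin.consEquiv fun _ : Fin (t + 1) => Fin n × Bool).sum_comp, Fintype.sum_prod_type,
    Finset.sum_comm]
  refine Finset.sum_congr rfl fun h _ => ?_
  rw [Fintype.sum_prod_type, Finset.mul_sum]
  refine Finset.sum_congr rfl fun a _ => ?_
  rw [Fintype.sum_bool]
  simp [Fin.consEquiv, historyProb, outcomeProb]
  ring

theorem expect_mono (hp : IsTransition p) (π : Policy n) {ω : Belief n} (hω : IsBelief ω)
    {t : ℕ} {F G : History n → ℝ} (hFG : ∀ h : History n, h.length = t → F h ≤ G h) :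
    expect p π ω t F ≤ expect p π ω t G :=
  Finset.sum_le_sum fun _ _ =>
    mul_le_mul_of_nonneg_left (hFG _ (List.length_ofFn)) (historyProb_nonneg hp π hω _)

/-- Expected reward over the next step and terminal value `f` when the channel is drawn from `q`. -/
def stepValue (p : Matrix (Fin 2) (Fin 2) ℝ) (q : stdSimplex ℝ (Fin n)) (f : Belief n → ℝ)
    (ω : Belief n) : ℝ :=
  ∑ a, q.1 a * actionValue p f ω a

theorem expect_succ_reward (π : Policy n) (ω : Belief n) (t : ℕ) (f : Belief n → ℝ) :
    expect p π ω (t + 1) (fun h => totalReward 1 h + f (beliefAfter p ω h)) =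
      expect p π ω t
        fun h => totalReward 1 h + stepValue p (π ω h) f (beliefAfter p ω h) := by
  rw [expect_succ]
  congr 1
  funext h
  have hsum : totalReward 1 h = ∑ a, (π ω h).1 a * totalReward 1 h := by
    rw [← Finset.sum_mul, (π ω h).2.2, one_mul]
  rw [hsum, stepValue, ← Finset.sum_add_distrib]
  refine Finset.sum_congr rfl fun a _ => ?_
  simp only [totalReward, actionValue, beliefAfter, one_pow, if_true, Bool.false_eq_true, if_false]
  ring

theorem expReward_eq_expect (π : Policy n) (ω : Belief n) (T : ℕ) :
    expReward p π 1 T ω =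
      expect p π ω T fun h => totalReward 1 h + (0 : Belief n → ℝ) (beliefAfter p ω h) := by
  simp [expReward, expect]

/-- Verification by backward induction: `U s` plays the role of a value with `s` steps to go, so
replacing the last step by its bound in terms of `U (s + 1)` can only increase the expectation. -/
theorem expReward_le (hp : IsTransition p) (π : Policy n) {ω : Belief n} (hω : IsBelief ω)
    {U : ℕ → Belief n → ℝ} (h0 : U 0 = 0) {T : ℕ}
    (hU : ∀ s h, h.length + (s + 1) = T →
      stepValue p (π ω h) (U s) (beliefAfter p ω h) ≤ U (s + 1) (beliefAfter p ω h)) :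
    expReward p π 1 T ω ≤ U T ω := by
  have key : ∀ t s, t + s = T →
      expect p π ω t (fun h => totalReward 1 h + U s (beliefAfter p ω h)) ≤ U T ω := by
    intro t
    induction t with
    | zero =>
      intro s hs
      rw [expect_zero, ← hs, zero_add]
      simp [totalReward, beliefAfter]
    | succ t ih =>
      intro s hs
      rw [expect_succ_reward]
      refine (expect_mono hp π hω fun h hh => ?_).trans (ih (s + 1) (by omega))
      have := hU s h (by omega)
      linarith
  rw [expReward_eq_expect, ← h0]
  exact key T 0 rfl

theorem le_expReward (hp : IsTransition p) (π : Policy n) {ω : Belief n} (hω : IsBelief ω)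
    {U : ℕ → Belief n → ℝ} (h0 : U 0 = 0) {T : ℕ}
    (hU : ∀ s h, h.length + (s + 1) = T →
      U (s + 1) (beliefAfter p ω h) ≤ stepValue p (π ω h) (U s) (beliefAfter p ω h)) :
    U T ω ≤ expReward p π 1 T ω := by
  have key : ∀ t s, t + s = T →
      U T ω ≤ expect p π ω t (fun h => totalReward 1 h + U s (beliefAfter p ω h)) := by
    intro t
    induction t with
    | zero =>
      intro s hs
      rw [expect_zero, ← hs, zero_add]
      simp [totalReward, beliefAfter]
    | succ t ih =>
      intro s hs
      rw [expect_succ_reward]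
      refine (ih (s + 1) (by omega)).trans (expect_mono hp π hω fun h hh => ?_)
      have := hU s h (by omega)
      linarith
  rw [expReward_eq_expect, ← h0]
  exact key T 0 rfl

theorem expReward_nonneg (hp : IsTransition p) (π : Policy n) {ω : Belief n} (hω : IsBelief ω)
    (T : ℕ) : 0 ≤ expReward p π 1 T ω :=
  Finset.sum_nonneg fun _ _ => mul_nonneg (historyProb_nonneg hp π hω _) (totalReward_nonneg _)

theorem actionValue_mono (hp : IsTransition p) {f g : Belief n → ℝ}
    (hfg : ∀ ω, IsBelief ω → f ω ≤ g ω) {ω : Belief n} (hω : IsBelief ω) (a : Fin n) :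
    actionValue p f ω a ≤ actionValue p g ω a := by
  have h1 := mul_le_mul_of_nonneg_left (hfg _ (isBelief_next hp hω a true)) (hω a).1
  have h2 := mul_le_mul_of_nonneg_left (hfg _ (isBelief_next hp hω a false))
    (sub_nonneg.2 (hω a).2)
  unfold actionValue
  linarith

theorem actionValue_congr (hp : IsTransition p) {f g : Belief n → ℝ}
    (hfg : ∀ ω, IsBelief ω → f ω = g ω) {ω : Belief n} (hω : IsBelief ω) (a : Fin n) :
    actionValue p f ω a = actionValue p g ω a :=
  le_antisymm (actionValue_mono hp (fun ω h => (hfg ω h).le) hω a)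
    (actionValue_mono hp (fun ω h => (hfg ω h).ge) hω a)

/-- Only the support of `q` matters; this is where `IsMyopic` gives information. -/
theorem stepValue_le {q : stdSimplex ℝ (Fin n)} {f : Belief n → ℝ} {ω : Belief n} {c : ℝ}
    (h : ∀ a, 0 < q.1 a → actionValue p f ω a ≤ c) : stepValue p q f ω ≤ c := by
  rw [← one_mul c, ← q.2.2, Finset.sum_mul]
  refine Finset.sum_le_sum fun a _ => ?_
  rcases (q.2.1 a).eq_or_lt with h0 | h0
  · change q.1 a * _ ≤ q.1 a * c
    rw [← (show 0 = q.1 a from h0)]; simp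
  · exact mul_le_mul_of_nonneg_left (h a h0) h0.le

theorem le_stepValue {q : stdSimplex ℝ (Fin n)} {f : Belief n → ℝ} {ω : Belief n} {c : ℝ}
    (h : ∀ a, 0 < q.1 a → c ≤ actionValue p f ω a) : c ≤ stepValue p q f ω := by
  rw [← one_mul c, ← q.2.2, Finset.sum_mul]
  refine Finset.sum_le_sum fun a _ => ?_
  rcases (q.2.1 a).eq_or_lt with h0 | h0
  · change q.1 a * c ≤ q.1 a * _
    rw [← (show 0 = q.1 a from h0)]; simp
  · exact mul_le_mul_of_nonneg_left (h a h0) h0.le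

/-! ### Finite-horizon values and the optimality hypothesis. -/

/-- Value of the stationary policy with decision rule `μ` over a finite horizon, by recursion on
the horizon. -/
def ruleValue (p : Matrix (Fin 2) (Fin 2) ℝ) (μ : Belief n → stdSimplex ℝ (Fin n)) :
    ℕ → Belief n → ℝ
  | 0 => 0
  | T + 1 => fun ω => stepValue p (μ ω) (ruleValue p μ T) ω

theorem expReward_stationaryPolicy (hp : IsTransition p) (μ : Belief n → stdSimplex ℝ (Fin n))
    {ω : Belief n} (hω : IsBelief ω) (T : ℕ) :
    expReward p (stationaryPolicy p μ) 1 T ω = ruleValue p μ T ω :=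
  le_antisymm (expReward_le hp _ hω rfl fun _ _ _ => le_rfl)
    (le_expReward hp _ hω rfl fun _ _ _ => le_rfl)

/-- Finite-horizon optimal value, by dynamic programming. -/
noncomputable def optValue (p : Matrix (Fin 2) (Fin 2) ℝ) : ℕ → Belief n → ℝ
  | 0 => 0
  | T + 1 => fun ω => ⨆ a, actionValue p (optValue p T) ω a

theorem actionValue_optValue_le (T : ℕ) (ω : Belief n) (a : Fin n) :
    actionValue p (optValue p T) ω a ≤ optValue p (T + 1) ω :=
  le_ciSup (f := actionValue p (optValue p T) ω) (Set.finite_range _).bddAbove a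

theorem expReward_le_optValue (hp : IsTransition p) (π : Policy n) {ω : Belief n}
    (hω : IsBelief ω) (T : ℕ) : expReward p π 1 T ω ≤ optValue p T ω :=
  expReward_le hp π hω rfl fun _ _ _ => stepValue_le fun a _ => actionValue_optValue_le _ _ a

theorem exists_markovPolicy_optValue_le [NeZero n] (hp : IsTransition p) (T : ℕ) :
    ∃ d : ℕ → Belief n → Fin n, ∀ ω, IsBelief ω →
      optValue p T ω ≤ expReward p (markovPolicy p d) 1 T ω := by
  have hmax : ∀ (s : ℕ) (ω : Belief n), ∃ a, actionValue p (optValue p s) ω a =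
      optValue p (s + 1) ω := fun s ω =>
    exists_eq_ciSup_of_finite (f := actionValue p (optValue p s) ω)
  choose d hd using hmax
  -- The maximizers are indexed by the steps left after the current one, the policy by elapsed time.
  refine ⟨fun t => d (T - 1 - t), fun ω hω => le_expReward hp _ hω rfl fun s h hs => ?_⟩
  refine le_stepValue fun a ha => ?_
  have hs' : T - 1 - h.length = s := by omega
  have ha' : a = d s (beliefAfter p ω h) := by
    by_contra hne
    simp [markovPolicy, hs', hne] at ha
  rw [ha', hd]

theorem optValue_eq_ruleValue [NeZero n] (hp : IsTransition p)
    {μ : Belief n → stdSimplex ℝ (Fin n)}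
    (hopt : OptimalFiniteHorizon p (stationaryPolicy p μ)) (T : ℕ) {ω : Belief n}
    (hω : IsBelief ω) : optValue p T ω = ruleValue p μ T ω := by
  rcases Nat.eq_zero_or_pos T with rfl | hT
  · rfl
  rw [← expReward_stationaryPolicy hp μ hω]
  refine le_antisymm ?_ (expReward_le_optValue hp _ hω T)
  obtain ⟨d, hd⟩ := exists_markovPolicy_optValue_le (n := n) hp T
  exact (hd ω hω).trans (hopt T hT 1 zero_le_one le_rfl ω hω d)

theorem actionValue_ruleValue_le [NeZero n] (hp : IsTransition p)
    {μ : Belief n → stdSimplex ℝ (Fin n)}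
    (hopt : OptimalFiniteHorizon p (stationaryPolicy p μ)) (T : ℕ) {ω : Belief n}
    (hω : IsBelief ω) (a : Fin n) :
    actionValue p (ruleValue p μ T) ω a ≤ ruleValue p μ (T + 1) ω := by
  rw [← optValue_eq_ruleValue hp hopt _ hω,
    actionValue_congr hp (fun ω h => (optValue_eq_ruleValue hp hopt T h).symm) hω]
  exact actionValue_optValue_le T ω a

/-! ### Reduction of strong optimality to convergence. -/

theorem stronglyOptimalAverage_of_tendsto [NeZero n] (hp : IsTransition p)
    {μ : Belief n → stdSimplex ℝ (Fin n)}
    (hopt : OptimalFiniteHorizon p (stationaryPolicy p μ))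
    (hlim : ∀ ω : Belief n, IsBelief ω → ∃ J : ℝ,
      Tendsto (fun T : ℕ => ruleValue p μ T ω / T) atTop (𝓝 J)) :
    StronglyOptimalAverage p (stationaryPolicy p μ) := by
  intro ω hω
  obtain ⟨J, hJ⟩ := hlim ω hω
  refine ⟨J, by simpa only [expReward_stationaryPolicy hp μ hω] using hJ, fun π' => ?_⟩
  rw [← hJ.limsup_eq]
  refine limsup_le_limsup (Eventually.of_forall fun T => ?_) ?_ hJ.isBoundedUnder_le
  · simp only [← optValue_eq_ruleValue hp hopt T hω]
    exact div_le_div_of_nonneg_right (expReward_le_optValue hp π' hω T) T.cast_nonneg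
  -- A real `limsup` is monotone only under boundedness conditions; nonnegative rewards supply this
  -- one.
  · refine isCoboundedUnder_le_of_le atTop (x := 0) fun T => ?_
    exact div_nonneg (expReward_nonneg hp π' hω T) T.cast_nonneg

theorem tendsto_div_of_abs_sub_le {u v : ℕ → ℝ} {J C : ℝ} (h : ∀ T, |u T - v T| ≤ C)
    (hv : Tendsto (fun T : ℕ => v T / T) atTop (𝓝 J)) :
    Tendsto (fun T : ℕ => u T / T) atTop (𝓝 J) := by
  have h0 : Tendsto (fun T : ℕ => (u T - v T) / T) atTop (𝓝 0) := by
    refine squeeze_zero_norm (a := fun T : ℕ => C / T) (fun T => ?_)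
      (tendsto_const_div_atTop_nhds_zero_nat C)
    rw [Real.norm_eq_abs, abs_div, Nat.abs_cast]
    exact div_le_div_of_nonneg_right (h T) T.cast_nonneg
  simpa [sub_div] using h0.add hv

/-! ### Lipschitz bounds uniform in the horizon. -/

theorem sum_abs_next_sub (a : Fin n) (o : Bool) (ω ω' : Belief n) :
    ∑ j, |next p ω a o j - next p ω' a o j| =
      |p 1 1 - p 0 1| * ∑ j ∈ Finset.univ.erase a, |ω j - ω' j| := by
  rw [← Finset.add_sum_erase _ _ (Finset.mem_univ a), Finset.mul_sum]
  simp only [next, if_true, sub_self, abs_zero, zero_add]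
  refine Finset.sum_congr rfl fun j hj => ?_
  rw [if_neg (Finset.ne_of_mem_erase hj), if_neg (Finset.ne_of_mem_erase hj), ← abs_mul]
  unfold tau
  congr 1
  ring

theorem sum_abs_next_true_sub_next_false (a : Fin n) (ω : Belief n) :
    ∑ j, |next p ω a true j - next p ω a false j| = |p 1 1 - p 0 1| := by
  rw [Finset.sum_eq_single a]
  · simp [next]
  · intro j _ hj
    simp [next, hj]
  · simp

/-- Changing `ω a` affects the reward and the outcome probabilities; the two outcomes lead to
beliefs at distance `δ`, so the cost per unit is at most `1 + L * δ ≤ L`. Changes in the other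
coordinates shrink by `δ` before `f` sees them. -/
theorem abs_actionValue_sub_le (hp : IsTransition p) {f : Belief n → ℝ} {L : ℝ}
    (hL' : 1 + L * |p 1 1 - p 0 1| ≤ L)
    (hf : ∀ ω ω', IsBelief ω → IsBelief ω' → |f ω - f ω'| ≤ L * ∑ j, |ω j - ω' j|)
    {ω ω' : Belief n} (hω : IsBelief ω) (hω' : IsBelief ω') (a : Fin n) :
    |actionValue p f ω a - actionValue p f ω' a| ≤ L * ∑ j, |ω j - ω' j| := by
  have h1 := hf _ _ (isBelief_next hp hω a true) (isBelief_next hp hω' a true)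
  have h2 := hf _ _ (isBelief_next hp hω a false) (isBelief_next hp hω' a false)
  have h3 := hf _ _ (isBelief_next hp hω a true) (isBelief_next hp hω a false)
  rw [sum_abs_next_sub] at h1 h2
  rw [sum_abs_next_true_sub_next_false] at h3
  rw [← Finset.add_sum_erase _ _ (Finset.mem_univ a)]
  set S := ∑ j ∈ Finset.univ.erase a, |ω j - ω' j|
  have hS : 0 ≤ S := Finset.sum_nonneg fun _ _ => abs_nonneg _
  have hS' : L * (|p 1 1 - p 0 1| * S) ≤ L * S := by
    rw [← mul_assoc]
    exact mul_le_mul_of_nonneg_right (by linarith) hS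
  have hsplit : actionValue p f ω a - actionValue p f ω' a =
      (ω a - ω' a) * (1 + (f (next p ω a true) - f (next p ω a false))) +
      (ω' a * (f (next p ω a true) - f (next p ω' a true)) +
        (1 - ω' a) * (f (next p ω a false) - f (next p ω' a false))) := by
    unfold actionValue; ring
  rw [hsplit, mul_add L]
  refine (abs_add_le _ _).trans (add_le_add ?_ ?_)
  · rw [abs_mul, mul_comm]
    refine mul_le_mul_of_nonneg_right ?_ (abs_nonneg _)
    refine (abs_add_le _ _).trans ?_
    rw [abs_one]
    linarith
  · refine (abs_add_le _ _).trans ?_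
    rw [abs_mul, abs_mul, abs_of_nonneg (hω' a).1, abs_of_nonneg (sub_nonneg.2 (hω' a).2)]
    have h4 := mul_le_mul_of_nonneg_left (h1.trans hS') (hω' a).1
    have h5 := mul_le_mul_of_nonneg_left (h2.trans hS') (sub_nonneg.2 (hω' a).2)
    linarith

theorem ruleValue_sub_le [NeZero n] (hp : IsTransition p) {μ : Belief n → stdSimplex ℝ (Fin n)}
    (hopt : OptimalFiniteHorizon p (stationaryPolicy p μ)) {L : ℝ} (hL : 0 ≤ L)
    (hL' : 1 + L * |p 1 1 - p 0 1| ≤ L) (T : ℕ) {ω ω' : Belief n} (hω : IsBelief ω)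
    (hω' : IsBelief ω') :
    |ruleValue p μ T ω - ruleValue p μ T ω'| ≤ L * ∑ j, |ω j - ω' j| := by
  induction T generalizing ω ω' with
  | zero =>
    simpa [ruleValue] using mul_nonneg hL (Finset.sum_nonneg fun j _ => abs_nonneg (ω j - ω' j))
  | succ T ih =>
    have key : ∀ {ω ω' : Belief n}, IsBelief ω → IsBelief ω' →
        ruleValue p μ (T + 1) ω ≤ ruleValue p μ (T + 1) ω' + L * ∑ j, |ω j - ω' j| := by
      intro ω ω' hω hω'
      -- An action used at `ω` is also available at `ω'`, where by optimality it does not beat the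
      -- rule.
      refine stepValue_le fun a _ => ?_
      have h1 := actionValue_ruleValue_le hp hopt T hω' a
      have h2 := le_of_abs_le
        (abs_actionValue_sub_le hp hL' (fun _ _ h h' => ih h h') hω hω' a)
      linarith
    have h1 := key hω hω'
    have h2 := key hω' hω
    simp only [abs_sub_comm (ω' _)] at h2
    exact abs_sub_le_iff.2 ⟨by linarith, by linarith⟩

/-- Under contraction of the belief dynamics the finite-horizon values have uniformly bounded
oscillation. -/
theorem exists_abs_ruleValue_sub_le [NeZero n] (hp : IsTransition p)
    (hδ : |p 1 1 - p 0 1| < 1) {μ : Belief n → stdSimplex ℝ (Fin n)}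
    (hopt : OptimalFiniteHorizon p (stationaryPolicy p μ)) :
    ∃ C : ℝ, ∀ T (ω ω' : Belief n), IsBelief ω → IsBelief ω' →
      |ruleValue p μ T ω - ruleValue p μ T ω'| ≤ C := by
  have hpos : 0 < 1 - |p 1 1 - p 0 1| := sub_pos.2 hδ
  have hL : 0 ≤ (1 - |p 1 1 - p 0 1|)⁻¹ := (inv_pos.2 hpos).le
  -- The Lipschitz constant solves `1 + L * δ = L`, and `[0,1]ⁿ` has `ℓ¹` diameter at most `n`.
  refine ⟨(1 - |p 1 1 - p 0 1|)⁻¹ * n, fun T ω ω' hω hω' => ?_⟩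
  refine (ruleValue_sub_le hp hopt hL ?_ T hω hω').trans (mul_le_mul_of_nonneg_left ?_ hL)
  · have := inv_mul_cancel₀ hpos.ne'
    linarith
  · calc ∑ j, |ω j - ω' j| ≤ ∑ _j : Fin n, (1 : ℝ) := Finset.sum_le_sum fun j _ =>
          abs_sub_le_iff.2 ⟨by linarith [(hω j).2, (hω' j).1], by linarith [(hω j).1, (hω' j).2]⟩
      _ = n := by simp

/-! ### The average-reward optimality equation. -/

theorem ruleValue_mem_Icc (hp : IsTransition p) (T : ℕ)
    (μ : Belief n → stdSimplex ℝ (Fin n)) {ω : Belief n} (hω : IsBelief ω) :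
    ruleValue p μ T ω ∈ Set.Icc (0 : ℝ) T := by
  induction T generalizing ω with
  | zero => simp [ruleValue]
  | succ T ih =>
    have key : ∀ a, actionValue p (ruleValue p μ T) ω a ∈ Set.Icc (0 : ℝ) (T + 1) := by
      intro a
      obtain ⟨h1, h2⟩ := ih (isBelief_next hp hω a true)
      obtain ⟨h3, h4⟩ := ih (isBelief_next hp hω a false)
      obtain ⟨h5, h6⟩ := hω a
      unfold actionValue
      constructor
      · have := mul_nonneg h5 h1
        have := mul_nonneg (sub_nonneg.2 h6) h3
        linarith
      · have := mul_le_mul_of_nonneg_left h2 h5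
        have := mul_le_mul_of_nonneg_left h4 (sub_nonneg.2 h6)
        linarith
    push_cast
    exact ⟨le_stepValue fun a _ => (key a).1, stepValue_le fun a _ => (key a).2⟩

theorem exists_tendsto_ultrafilter {u : ℕ → ℝ} {C : ℝ} (h : ∀ N : ℕ, |u N| ≤ C)
    (F : Ultrafilter ℕ) : ∃ l, |l| ≤ C ∧ Tendsto u F (𝓝 l) := by
  obtain ⟨l, hl, hle⟩ := (isCompact_Icc (a := -C) (b := C)).ultrafilter_le_nhds (F.map u)
    (le_principal_iff.2 (mem_map.2 (univ_mem' fun N => abs_le.1 (h N))))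
  exact ⟨l, abs_le.2 hl, hle⟩

/-- Averages over the horizon of the values relative to the value at a reference point. -/
noncomputable def relativeAverage (v : ℕ → Belief n → ℝ) (ω₀ : Belief n) (N : ℕ)
    (ω : Belief n) : ℝ :=
  (∑ T ∈ Finset.range N, (v T ω - v T ω₀)) / N

theorem abs_relativeAverage_le {v : ℕ → Belief n → ℝ} {ω₀ ω : Belief n} {C : ℝ} (hC : 0 ≤ C)
    (h : ∀ T, |v T ω - v T ω₀| ≤ C) (N : ℕ) : |relativeAverage v ω₀ N ω| ≤ C := by
  unfold relativeAverage
  rw [abs_div, Nat.abs_cast]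
  refine div_le_of_le_mul₀ N.cast_nonneg hC ?_
  calc _ ≤ ∑ T ∈ Finset.range N, |v T ω - v T ω₀| := Finset.abs_sum_le_sum_abs _ _
    _ ≤ ∑ T ∈ Finset.range N, C := Finset.sum_le_sum fun T _ => h T
    _ = C * N := by simp [mul_comm]

theorem actionValue_relativeAverage (v : ℕ → Belief n → ℝ) (ω₀ : Belief n) {N : ℕ} (hN : N ≠ 0)
    (ω : Belief n) (a : Fin n) :
    actionValue p (relativeAverage v ω₀ N) ω a =
      (∑ T ∈ Finset.range N, (actionValue p (v T) ω a - v T ω₀)) / N := by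
  have hN' : (N : ℝ) ≠ 0 := Nat.cast_ne_zero.2 hN
  rw [eq_div_iff hN']
  unfold actionValue relativeAverage
  have : ∀ x y : ℝ, (ω a + ω a * (x / N) + (1 - ω a) * (y / N)) * N =
      N * ω a + (ω a * x + (1 - ω a) * y) := by
    intro x y
    field_simp
    ring
  rw [this, Finset.mul_sum, Finset.mul_sum, ← Finset.sum_add_distrib]
  have h1 : (N : ℝ) * ω a = ∑ T ∈ Finset.range N, ω a := by simp
  rw [h1, ← Finset.sum_add_distrib]
  exact Finset.sum_congr rfl fun T _ => by ring

/-- This is why averages are used: shifting `T` by one telescopes to `v N ω / N`, so no convergence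
of the increments `v (T + 1) ω - v T ω` is needed. -/
theorem relativeAverage_add {v : ℕ → Belief n → ℝ} (h0 : v 0 = 0) (ω₀ : Belief n) (N : ℕ)
    (ω : Belief n) :
    relativeAverage v ω₀ N ω + v N ω / N =
      (∑ T ∈ Finset.range N, (v (T + 1) ω - v T ω₀)) / N := by
  unfold relativeAverage
  rw [← add_div]
  congr 1
  have : v N ω = ∑ T ∈ Finset.range N, (v (T + 1) ω - v T ω) := by
    rw [Finset.sum_range_sub (fun T => v T ω), h0]
    simp
  rw [this, ← Finset.sum_add_distrib]
  exact Finset.sum_congr rfl fun T _ => by ring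

theorem tendsto_actionValue {F : Filter ℕ} {h : ℕ → Belief n → ℝ} {f : Belief n → ℝ}
    (hp : IsTransition p) (hf : ∀ ω, IsBelief ω → Tendsto (fun N => h N ω) F (𝓝 (f ω)))
    {ω : Belief n} (hω : IsBelief ω) (a : Fin n) :
    Tendsto (fun N => actionValue p (h N) ω a) F (𝓝 (actionValue p f ω a)) := by
  unfold actionValue
  exact (((hf _ (isBelief_next hp hω a true)).const_mul _).const_add _).add
    ((hf _ (isBelief_next hp hω a false)).const_mul _)

theorem exists_canonicalTriplet [NeZero n] (hp : IsTransition p) (hδ : |p 1 1 - p 0 1| < 1)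
    {μ : Belief n → stdSimplex ℝ (Fin n)}
    (hopt : OptimalFiniteHorizon p (stationaryPolicy p μ)) :
    ∃ (J : ℝ) (f : Belief n → ℝ), (∃ C : ℝ, ∀ ω, IsBelief ω → |f ω| ≤ C) ∧
      IsCanonicalTriplet p J f μ := by
  obtain ⟨C, hC⟩ := exists_abs_ruleValue_sub_le hp hδ hopt
  set v := ruleValue p μ with hv
  let ω₀ : Belief n := 0
  have hω₀ : IsBelief ω₀ := fun i => ⟨le_rfl, zero_le_one⟩
  have hC0 : 0 ≤ C := (abs_nonneg _).trans (hC 0 ω₀ ω₀ hω₀ hω₀)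
  let F : Ultrafilter ℕ := hyperfilter ℕ
  have hF : (F : Filter ℕ) ≤ atTop := Nat.hyperfilter_le_atTop
  obtain ⟨J, -, hJ₀⟩ := exists_tendsto_ultrafilter (u := fun N : ℕ => v N ω₀ / N) (C := 1)
    (fun N : ℕ => by
      obtain ⟨h1, h2⟩ := ruleValue_mem_Icc hp N μ hω₀
      rw [abs_of_nonneg (div_nonneg h1 N.cast_nonneg)]
      exact div_le_one_of_le₀ h2 N.cast_nonneg) F
  -- Bounded oscillation makes the limit independent of the starting belief.
  have hJ : ∀ ω, IsBelief ω → Tendsto (fun N : ℕ => v N ω / N) F (𝓝 J) := by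
    intro ω hω
    have h0 : Tendsto (fun N : ℕ => (v N ω - v N ω₀) / N) F (𝓝 0) := by
      refine Tendsto.mono_left ?_ hF
      refine squeeze_zero_norm (a := fun N : ℕ => C / N) (fun N => ?_)
        (tendsto_const_div_atTop_nhds_zero_nat C)
      rw [Real.norm_eq_abs, abs_div, Nat.abs_cast]
      exact div_le_div_of_nonneg_right (hC N ω ω₀ hω hω₀) N.cast_nonneg
    simpa [sub_div] using h0.add hJ₀
  have hlim : ∀ ω : Belief n, ∃ l, IsBelief ω →
      |l| ≤ C ∧ Tendsto (fun N => relativeAverage v ω₀ N ω) F (𝓝 l) := by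
    intro ω
    by_cases hω : IsBelief ω
    · obtain ⟨l, h⟩ := exists_tendsto_ultrafilter
        (abs_relativeAverage_le hC0 fun T => hC T ω ω₀ hω hω₀) F
      exact ⟨l, fun _ => h⟩
    · exact ⟨0, fun h => absurd h hω⟩
  choose f hf using hlim
  refine ⟨J, f, ⟨C, fun ω hω => (hf ω hω).1⟩, fun ω hω => ?_⟩
  have hlhs : Tendsto (fun N => relativeAverage v ω₀ N ω + v N ω / N) F (𝓝 (f ω + J)) :=
    (hf ω hω).2.add (hJ ω hω)
  have hrhs := tendsto_actionValue hp (fun ω hω => (hf ω hω).2) hω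
  have hN : ∀ᶠ N : ℕ in F, N ≠ 0 := hF (eventually_ne_atTop 0)
  -- A maximum does not commute with averaging, but the inequality for each fixed action and the
  -- equality for the rule `μ` are affine in the value function, so both survive averages and
  -- limits.
  have hle : ∀ a, actionValue p f ω a ≤ J + f ω := by
    intro a
    rw [add_comm]
    refine le_of_tendsto_of_tendsto (hrhs a) hlhs (hN.mono fun N hN => ?_)
    simp only [actionValue_relativeAverage v ω₀ hN, relativeAverage_add (v := v) rfl]
    refine div_le_div_of_nonneg_right (Finset.sum_le_sum fun T _ => ?_) N.cast_nonneg
    exact sub_le_sub_right (actionValue_ruleValue_le hp hopt T hω a) _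
  have heq : J + f ω = ∑ a, (μ ω).1 a * actionValue p f ω a := by
    rw [add_comm]
    refine tendsto_nhds_unique_of_eventuallyEq hlhs
      (tendsto_finsetSum _ fun a _ => (hrhs a).const_mul _) (hN.mono fun N hN => ?_)
    simp only [actionValue_relativeAverage v ω₀ hN, relativeAverage_add (v := v) rfl]
    simp only [← mul_div_assoc, Finset.mul_sum]
    rw [← Finset.sum_div, Finset.sum_comm]
    congr 1
    refine Finset.sum_congr rfl fun T _ => ?_
    simp only [mul_sub]
    rw [Finset.sum_sub_distrib, ← Finset.sum_mul, (μ ω).2.2, one_mul]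
    rfl
  refine ⟨⟨?_, ?_⟩, heq⟩
  -- A weighted average of the action values equals the bound, so they cannot all lie strictly below
  -- it.
  · by_contra hne
    have hlt : ∀ a, actionValue p f ω a < J + f ω := fun a =>
      (hle a).lt_of_ne fun h => hne ⟨a, h⟩
    obtain ⟨a, ha⟩ : ∃ a, actionValue p f ω a = ⨆ b, actionValue p f ω b :=
      exists_eq_ciSup_of_finite
    have h1 : stepValue p (μ ω) f ω ≤ actionValue p f ω a := stepValue_le fun b _ =>
      ha ▸ le_ciSup (f := actionValue p f ω) (Set.finite_range _).bddAbove b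
    exact (hlt a).not_ge (heq.trans_le h1)
  · rintro _ ⟨a, rfl⟩
    exact hle a

/-! ### Linear growth of the values from a canonical triplet. -/

theorem actionValue_add_const (f : Belief n → ℝ) (c : ℝ) (ω : Belief n) (a : Fin n) :
    actionValue p (fun ω => f ω + c) ω a = actionValue p f ω a + c := by
  unfold actionValue; ring

theorem stepValue_add_const (q : stdSimplex ℝ (Fin n)) (f : Belief n → ℝ) (c : ℝ)
    (ω : Belief n) : stepValue p q (fun ω => f ω + c) ω = stepValue p q f ω + c := by
  simp only [stepValue, actionValue_add_const, mul_add]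
  rw [Finset.sum_add_distrib, ← Finset.sum_mul, q.2.2, one_mul]

theorem stepValue_mono (hp : IsTransition p) {f g : Belief n → ℝ}
    (hfg : ∀ ω, IsBelief ω → f ω ≤ g ω) {ω : Belief n} (hω : IsBelief ω)
    (q : stdSimplex ℝ (Fin n)) : stepValue p q f ω ≤ stepValue p q g ω :=
  Finset.sum_le_sum fun a _ => mul_le_mul_of_nonneg_left (actionValue_mono hp hfg hω a) (q.2.1 a)

theorem IsCanonicalTriplet.tendsto_ruleValue (hp : IsTransition p)
    {μ : Belief n → stdSimplex ℝ (Fin n)} {J C : ℝ} {f : Belief n → ℝ}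
    (h : IsCanonicalTriplet p J f μ) (hC : ∀ ω, IsBelief ω → |f ω| ≤ C) {ω : Belief n}
    (hω : IsBelief ω) : Tendsto (fun T : ℕ => ruleValue p μ T ω / T) atTop (𝓝 J) := by
  have hstep : ∀ ω, IsBelief ω → stepValue p (μ ω) f ω = f ω + J := fun ω hω => by
    rw [add_comm]; exact (h ω hω).2.symm
  have key : ∀ (T : ℕ) (ω), IsBelief ω →
      f ω + (T * J - C) ≤ ruleValue p μ T ω ∧ ruleValue p μ T ω ≤ f ω + (T * J + C) := by
    intro T
    induction T with
    | zero =>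
      intro ω hω
      have := abs_le.1 (hC ω hω)
      simp only [ruleValue, Pi.zero_apply, Nat.cast_zero, zero_mul]
      constructor <;> linarith
    | succ T ih =>
      intro ω hω
      have h1 := stepValue_mono hp (fun ω hω => (ih ω hω).1) hω (μ ω)
      have h2 := stepValue_mono hp (fun ω hω => (ih ω hω).2) hω (μ ω)
      rw [stepValue_add_const, hstep ω hω] at h1 h2
      have h3 : ruleValue p μ (T + 1) ω = stepValue p (μ ω) (ruleValue p μ T) ω := rfl
      rw [h3]
      push_cast
      constructor <;> linarith
  refine tendsto_div_of_abs_sub_le (v := fun T => T * J) (C := 2 * C) (fun T => ?_) ?_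
  · have h1 := key T ω hω
    have h2 := abs_le.1 (hC ω hω)
    exact abs_le.2 ⟨by linarith, by linarith⟩
  · refine tendsto_const_nhds.congr' ((eventually_ne_atTop 0).mono fun T hT => ?_)
    have : (T : ℝ) ≠ 0 := Nat.cast_ne_zero.2 hT
    field_simp

/-! ### Frozen and alternating channels. -/

/-- Number of channels whose state is not known with certainty. -/
noncomputable def numUncertain (ω : Belief n) : ℝ := ∑ i, if ω i = 0 ∨ ω i = 1 then 0 else 1

/-- Probability that no channel is good. -/
def probAllBad (ω : Belief n) : ℝ := ∏ i, (1 - ω i)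

/-- Probability that all channels are good. -/
def probAllGood (ω : Belief n) : ℝ := ∏ i, ω i

theorem numUncertain_nonneg (ω : Belief n) : 0 ≤ numUncertain ω :=
  Finset.sum_nonneg fun i _ => by split_ifs <;> simp

theorem numUncertain_next (hτ : ∀ x, tau p x = 0 ∨ tau p x = 1 ↔ x = 0 ∨ x = 1)
    (h1 : p 1 1 = 0 ∨ p 1 1 = 1) (h0 : p 0 1 = 0 ∨ p 0 1 = 1) (ω : Belief n) (a : Fin n)
    (o : Bool) :
    numUncertain (next p ω a o) = numUncertain ω - if ω a = 0 ∨ ω a = 1 then 0 else 1 := by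
  unfold numUncertain
  rw [← Finset.add_sum_erase _ _ (Finset.mem_univ a),
    ← Finset.add_sum_erase (a := a) _ (fun i => if ω i = 0 ∨ ω i = 1 then (0 : ℝ) else 1)
      (Finset.mem_univ a), add_sub_cancel_left]
  have hnext : next p ω a o a = 0 ∨ next p ω a o a = 1 := by
    cases o <;> simpa [next]
  rw [if_pos hnext, zero_add]
  refine Finset.sum_congr rfl fun j hj => ?_
  simp only [next, if_neg (Finset.ne_of_mem_erase hj), hτ]

theorem probAllBad_mem_Icc {ω : Belief n} (hω : IsBelief ω) :
    probAllBad ω ∈ Set.Icc (0 : ℝ) 1 :=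
  ⟨Finset.prod_nonneg fun i _ => sub_nonneg.2 (hω i).2,
    Finset.prod_le_one (fun i _ => sub_nonneg.2 (hω i).2) fun i _ => sub_le_self _ (hω i).1⟩

theorem probAllGood_mem_Icc {ω : Belief n} (hω : IsBelief ω) :
    probAllGood ω ∈ Set.Icc (0 : ℝ) 1 :=
  ⟨Finset.prod_nonneg fun i _ => (hω i).1,
    Finset.prod_le_one (fun i _ => (hω i).1) fun i _ => (hω i).2⟩

theorem le_one_sub_probAllBad {ω : Belief n} (hω : IsBelief ω) (a : Fin n) :
    ω a ≤ 1 - probAllBad ω := by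
  have h : probAllBad ω ≤ 1 - ω a := by
    unfold probAllBad
    rw [← Finset.mul_prod_erase _ _ (Finset.mem_univ a)]
    exact mul_le_of_le_one_right (sub_nonneg.2 (hω a).2)
      (Finset.prod_le_one (fun i _ => sub_nonneg.2 (hω i).2) fun i _ => sub_le_self _ (hω i).1)
  linarith

/-- Sensing a channel of maximal belief forgoes an immediate reward only if the state of that
channel is uncertain. -/
theorem one_sub_probAllBad_sub_le {ω : Belief n} (hω : IsBelief ω) {a : Fin n}
    (ha : ∀ b, ω b ≤ ω a) :
    1 - probAllBad ω - ω a ≤ if ω a = 0 ∨ ω a = 1 then 0 else 1 := by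
  have hB := (probAllBad_mem_Icc hω).1
  split_ifs with h
  · rcases h with h | h
    · have h0 : ∀ b, ω b = 0 := fun b => le_antisymm (h ▸ ha b) (hω b).1
      simp [probAllBad, h0]
    · rw [h]
      linarith
  · linarith [(hω a).1]

/-- By `hG`, sensing `a` loses `1 - probAllBad ω - ω a` against the potential. For a myopic choice
the loss is paid by a drop of `numUncertain`; for any choice it is nonnegative. The slack `1`
absorbs `G 0`. -/
theorem ruleValue_mem_Icc_of_potential (hp : IsTransition p)
    (hτ : ∀ x, tau p x = 0 ∨ tau p x = 1 ↔ x = 0 ∨ x = 1)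
    (h1 : p 1 1 = 0 ∨ p 1 1 = 1) (h0 : p 0 1 = 0 ∨ p 0 1 = 1)
    {μ : Belief n → stdSimplex ℝ (Fin n)} (hμ : IsMyopic μ) {G : ℕ → Belief n → ℝ}
    (hG0 : ∀ ω, IsBelief ω → |G 0 ω| ≤ 1)
    (hG : ∀ T ω a, actionValue p (G T) ω a = G (T + 1) ω + (ω a - (1 - probAllBad ω)))
    (T : ℕ) {ω : Belief n} (hω : IsBelief ω) :
    ruleValue p μ T ω ∈ Set.Icc (G T ω - numUncertain ω - 1) (G T ω + 1) := by
  induction T generalizing ω with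
  | zero =>
    have := abs_le.1 (hG0 ω hω)
    have := numUncertain_nonneg ω
    simp only [ruleValue, Pi.zero_apply]
    constructor <;> linarith
  | succ T ih =>
    constructor
    · refine le_stepValue fun a ha => ?_
      refine le_trans ?_ (actionValue_mono hp (fun ω h => (ih h).1) hω a)
      have h2 := one_sub_probAllBad_sub_le hω (hμ ω hω a ha)
      have h3 := hG T ω a
      unfold actionValue at h3 ⊢
      beta_reduce
      rw [numUncertain_next hτ h1 h0, numUncertain_next hτ h1 h0]
      linarith
    · refine stepValue_le fun a _ => ?_
      refine (actionValue_mono hp (fun ω h => (ih h).2) hω a).trans ?_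
      have h2 := le_one_sub_probAllBad hω a
      rw [actionValue_add_const, hG]
      linarith

theorem tendsto_ruleValue_of_potential (hp : IsTransition p)
    (hτ : ∀ x, tau p x = 0 ∨ tau p x = 1 ↔ x = 0 ∨ x = 1)
    (h1 : p 1 1 = 0 ∨ p 1 1 = 1) (h0 : p 0 1 = 0 ∨ p 0 1 = 1)
    {μ : Belief n → stdSimplex ℝ (Fin n)} (hμ : IsMyopic μ) {g e : Belief n → ℝ}
    (he : ∀ ω, IsBelief ω → |e ω| ≤ 1)
    (hG : ∀ (T : ℕ) ω a, actionValue p (fun ω => T * g ω + e ω) ω a =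
      (T + 1) * g ω + e ω + (ω a - (1 - probAllBad ω)))
    {ω : Belief n} (hω : IsBelief ω) :
    Tendsto (fun T : ℕ => ruleValue p μ T ω / T) atTop (𝓝 (g ω)) := by
  -- The `2` is the slack `1` plus the bound on `e`.
  refine tendsto_div_of_abs_sub_le (v := fun T => T * g ω) (C := numUncertain ω + 2)
    (fun T => ?_) ?_
  · obtain ⟨h2, h3⟩ := ruleValue_mem_Icc_of_potential hp hτ h1 h0 hμ
      (G := fun T ω => T * g ω + e ω) (by simpa using he)
      (fun T ω a => by push_cast; exact hG T ω a) T hω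
    have h4 := abs_le.1 (he ω hω)
    have h5 := numUncertain_nonneg ω
    exact abs_le.2 ⟨by linarith, by linarith⟩
  · refine tendsto_const_nhds.congr' ((eventually_ne_atTop 0).mono fun T hT => ?_)
    have : (T : ℝ) ≠ 0 := Nat.cast_ne_zero.2 hT
    field_simp

theorem prod_next (φ : ℝ → ℝ) (ω : Belief n) (a : Fin n) (o : Bool) :
    ∏ i, φ (next p ω a o i) =
      φ (if o then p 1 1 else p 0 1) * ∏ i ∈ Finset.univ.erase a, φ (tau p (ω i)) := by
  rw [← Finset.mul_prod_erase _ _ (Finset.mem_univ a)]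
  congr 1
  · simp [next]
  · exact Finset.prod_congr rfl fun j hj => by simp [next, Finset.ne_of_mem_erase hj]

/-- Convergence of the average rewards of a myopic rule when the states never change. -/
theorem tendsto_ruleValue_of_static (hp : IsTransition p) (h1 : p 1 1 = 1) (h0 : p 0 1 = 0)
    {μ : Belief n → stdSimplex ℝ (Fin n)} (hμ : IsMyopic μ) {ω : Belief n} (hω : IsBelief ω) :
    Tendsto (fun T : ℕ => ruleValue p μ T ω / T) atTop (𝓝 (1 - probAllBad ω)) := by
  have hτ : ∀ x, tau p x = x := fun x => by simp [tau, h1, h0]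
  refine tendsto_ruleValue_of_potential (g := fun ω => 1 - probAllBad ω) (e := fun _ => 0) hp
    (by simp [hτ]) (Or.inr h1) (Or.inl h0) hμ (by simp) (fun T ω a => ?_) hω
  have hB : probAllBad ω = (1 - ω a) * ∏ i ∈ Finset.univ.erase a, (1 - ω i) :=
    (Finset.mul_prod_erase _ _ (Finset.mem_univ a)).symm
  unfold actionValue
  beta_reduce
  rw [show probAllBad (next p ω a true) = _ from prod_next (fun x => 1 - x) ω a true,
    show probAllBad (next p ω a false) = _ from prod_next (fun x => 1 - x) ω a false, hB]
  simp only [hτ, h1, h0, if_true, Bool.false_eq_true, if_false]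
  ring

/-- Convergence of the average rewards of a myopic rule when the states alternate. -/
theorem tendsto_ruleValue_of_alternating (hp : IsTransition p) (h1 : p 1 1 = 0) (h0 : p 0 1 = 1)
    {μ : Belief n → stdSimplex ℝ (Fin n)} (hμ : IsMyopic μ) {ω : Belief n} (hω : IsBelief ω) :
    Tendsto (fun T : ℕ => ruleValue p μ T ω / T) atTop
      (𝓝 (1 - (probAllGood ω + probAllBad ω) / 2)) := by
  have hτ : ∀ x, tau p x = 1 - x := fun x => by simp [tau, h1, h0]
  -- Each flip swaps the all-good and all-bad events, so `g` is the mean of the two alternating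
  -- rewards. The correction `e` changes sign in expectation at each step, so `2 * e = 1 -
  -- probAllBad - g`.
  refine tendsto_ruleValue_of_potential (g := fun ω => 1 - (probAllGood ω + probAllBad ω) / 2)
    (e := fun ω => (probAllGood ω - probAllBad ω) / 4) hp (fun x => ?_) (Or.inl h1) (Or.inr h0)
    hμ (fun ω hω => ?_) (fun T ω a => ?_) hω
  · rw [hτ]
    constructor <;> rintro (h | h) <;> [right; left; right; left] <;> linarith
  · obtain ⟨h2, h3⟩ := probAllGood_mem_Icc hω
    obtain ⟨h4, h5⟩ := probAllBad_mem_Icc hω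
    exact abs_le.2 ⟨by linarith, by linarith⟩
  · have hB : probAllBad ω = (1 - ω a) * ∏ i ∈ Finset.univ.erase a, (1 - ω i) :=
      (Finset.mul_prod_erase _ _ (Finset.mem_univ a)).symm
    have hA : probAllGood ω = ω a * ∏ i ∈ Finset.univ.erase a, ω i :=
      (Finset.mul_prod_erase _ _ (Finset.mem_univ a)).symm
    unfold actionValue
    beta_reduce
    rw [show probAllBad (next p ω a true) = _ from prod_next (fun x => 1 - x) ω a true,
      show probAllBad (next p ω a false) = _ from prod_next (fun x => 1 - x) ω a false,
      show probAllGood (next p ω a true) = _ from prod_next (fun x => x) ω a true,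
      show probAllGood (next p ω a false) = _ from prod_next (fun x => x) ω a false, hA, hB]
    simp only [hτ, h1, h0, if_true, Bool.false_eq_true, if_false, sub_sub_cancel]
    ring

/-! ### Assembly of the cases. -/

theorem exists_tendsto_ruleValue [NeZero n] (hp : IsTransition p)
    {μ : Belief n → stdSimplex ℝ (Fin n)} (hμ : IsMyopic μ)
    (hopt : OptimalFiniteHorizon p (stationaryPolicy p μ)) {ω : Belief n} (hω : IsBelief ω) :
    ∃ J : ℝ, Tendsto (fun T : ℕ => ruleValue p μ T ω / T) atTop (𝓝 J) := by
  by_cases hδ : |p 1 1 - p 0 1| < 1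
  · obtain ⟨J, f, ⟨C, hC⟩, hJ⟩ := exists_canonicalTriplet hp hδ hopt
    exact ⟨J, hJ.tendsto_ruleValue hp hC hω⟩
  -- Two numbers in `[0,1]` at distance at least `1` are `0` and `1`.
  · obtain ⟨⟨h1, h2⟩, h3, h4⟩ := id hp
    rcases le_abs'.1 (not_lt.1 hδ) with h | h
    · exact ⟨_, tendsto_ruleValue_of_alternating hp (by linarith) (by linarith) hμ hω⟩
    · exact ⟨_, tendsto_ruleValue_of_static hp (by linarith) (by linarith) hμ hω⟩

end ChannelSensing

theorem theorem4 (n : ℕ) (p : Matrix (Fin 2) (Fin 2) ℝ)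
    (hp : p ∈ Matrix.rowStochastic ℝ (Fin 2))
    (μ : ChannelSensing.Belief n → stdSimplex ℝ (Fin n))
    (hμ : ChannelSensing.IsMyopic μ)
    (hopt : ChannelSensing.OptimalFiniteHorizon p (ChannelSensing.stationaryPolicy p μ)) :
    (|p 1 1 - p 0 0| < 1 →
      ChannelSensing.StronglyOptimalAverage p (ChannelSensing.stationaryPolicy p μ)) ∧
    (|p 1 1 - p 0 1| < 1 →
      ChannelSensing.StronglyOptimalAverage p (ChannelSensing.stationaryPolicy p μ) ∧
      ∃ (J : ℝ) (f : ChannelSensing.Belief n → ℝ),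
        (∃ C : ℝ, ∀ ω, ChannelSensing.IsBelief ω → |f ω| ≤ C) ∧
        ChannelSensing.IsCanonicalTriplet p J f μ ∧
        ∀ ω, ChannelSensing.IsBelief ω →
          Filter.Tendsto
            (fun T : ℕ =>
              ChannelSensing.expReward p (ChannelSensing.stationaryPolicy p μ) 1 T ω / T)
            Filter.atTop (nhds J)) := by
  have hT := ChannelSensing.isTransition_of_mem_rowStochastic hp
  -- The simplex on no channels is empty, so a decision rule forces `n ≠ 0`.
  have : NeZero n := ⟨by
    rintro rfl
    simpa using (μ 0).2.2⟩
  have hstrong : ChannelSensing.StronglyOptimalAverage p (ChannelSensing.stationaryPolicy p μ) :=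
    ChannelSensing.stronglyOptimalAverage_of_tendsto hT hopt fun _ hω =>
      ChannelSensing.exists_tendsto_ruleValue hT hμ hopt hω
  refine ⟨fun _ => hstrong, fun hδ => ⟨hstrong, ?_⟩⟩
  obtain ⟨J, f, ⟨C, hC⟩, hJ⟩ := ChannelSensing.exists_canonicalTriplet hT hδ hopt
  refine ⟨J, f, ⟨C, hC⟩, hJ, fun ω hω => ?_⟩
  simp only [ChannelSensing.expReward_stationaryPolicy hT μ hω]
  exact hJ.tendsto_ruleValue hT hC hω
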